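/- Let $(W,\mathrm d)$ be a closed Hilbert complex: real Hilbert spaces $W^k$ ($k\in\mathbb Z$) with closed, densely defined linear maps $\mathrm d^k\colon V^k\subset W^k\to V^{k+1}\subset W^{k+1}$ such that $\mathrm d^{k+1}\circ\mathrm d^{k}=0$ and $\mathrm d^kV^k$ is closed in $W^{k+1}$ for each $k$. Write $\langle\cdot,\cdot\rangle$ and $\|\cdot\|$ for the inner product and norm of $W^k$, and $\|v\|_V=(\|v\|^2+\|\mathrm d^k v\|^2)^{1/2}$ for $v\in V^k$. Let $\mathfrak Z^k=\ker\mathrm d^k$, $\mathfrak B^k=\mathrm d^{k-1}V^{k-1}$ and $\mathfrak H^k=\mathfrak Z^k\cap\mathfrak B^{k\perp}$. Fix $k$ and let $F\colon V^k\to W^k$ be a (nonlinear) operator that is monotone, $\langle Fu-Fv,u-v\rangle\ge 0$ for all $u,v\in V^k$, and Lipschitz in the $V$-norm, $\|Fu-Fv\|\le L\|u-v\|_V$ for all $u,v\in V^k$. Then for every $f\in W^k$ the mixed semilinear problem $$\begin{aligned} \langle\sigma,\tau\rangle-\langle u,\mathrm d\tau\rangle&=0 &&\forall\,\tau\in V^{k-1},\\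 \langle\mathrm d\sigma,v\rangle+\langle\mathrm du,\mathrm dv\rangle+\langle p,v\rangle+\langle F(u+p),v\rangle&=\langle f,v\rangle &&\forall\,v\in V^k,\\ \langle u,q\rangle&=0 &&\forall\,q\in\mathfrak H^k \end{aligned}$$ has a unique solution $(\sigma,u,p)\in V^{k-1}\times V^k\times\mathfrak H^k$. Moreover, there is a constant $c_P$ (a Poincaré constant) such that $\|v\|_V\le c_P\|\mathrm d^j v\|$ for all $v\in V^j$ with $v\perp\mathfrak Z^j$, $j\in\{k-1,k\}$; and for any such $c_P$, if $(\sigma,u,p)$ and $(\sigma',u',p')$ are the solutions for $f,f'\in W^k$, then $$\|\sigma-\sigma'\|_V+\|u-u'\|_V+\|p-p'\|\le C\,\|f-f'\|,$$ where $C$ depends only on $c_P$ and $L$ (and not otherwise on the complex, on $k$, or on $F$). -/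

import Mathlib

open scoped InnerProductSpace

universe u

/-- A Hilbert complex `(W, d)` on a sequence of real Hilbert spaces `W k`, `k : ℤ`: closed, densely
defined (possibly unbounded) linear maps `d k : V k ⊆ W k → V (k + 1) ⊆ W (k + 1)` with
`d (k + 1) ∘ d k = 0`. The domain `V k` is `(d k).domain`. -/
structure HilbertComplex (W : ℤ → Type u) [∀ k, NormedAddCommGroup (W k)]
    [∀ k, InnerProductSpace ℝ (W k)] [∀ k, CompleteSpace (W k)] where
  /-- the differentials -/
  d : ∀ k : ℤ, W k →ₗ.[ℝ] W (k + 1)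
  dense_domain : ∀ k, Dense ((d k).domain : Set (W k))
  isClosed_d : ∀ k, (d k).IsClosed
  d_mem_domain : ∀ (k : ℤ) (v : (d k).domain), d k v ∈ (d (k + 1)).domain
  d_comp_d : ∀ (k : ℤ) (v : (d k).domain), d (k + 1) ⟨d k v, d_mem_domain k v⟩ = 0

namespace HilbertComplex

variable {W : ℤ → Type u} [∀ k, NormedAddCommGroup (W k)]
    [∀ k, InnerProductSpace ℝ (W k)] [∀ k, CompleteSpace (W k)]

/-- The domain `V^k ⊆ W^k` of `d^k`. As a subtype of `W k` it carries the `W`-inner product and the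
`W`-norm; the graph inner product and norm are `innerV` and `normV` below. -/
abbrev V (X : HilbertComplex W) (k : ℤ) : Submodule ℝ (W k) := (X.d k).domain

/-- The graph inner product `⟨u, v⟩_V = ⟨u, v⟩ + ⟨d u, d v⟩` on `V^k`. -/
noncomputable def innerV (X : HilbertComplex W) {k : ℤ} (u v : X.V k) : ℝ :=
  ⟪(u : W k), (v : W k)⟫_ℝ + ⟪X.d k u, X.d k v⟫_ℝ

/-- The norm `‖v‖_V` of the graph inner product on `V^k`. -/
noncomputable def normV (X : HilbertComplex W) {k : ℤ} (v : X.V k) : ℝ :=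
  Real.sqrt (X.innerV v v)

/-- The complex is closed if the image `d^k V^k` is closed in `W^{k+1}` for every `k`. -/
def IsClosedComplex (X : HilbertComplex W) : Prop :=
  ∀ k : ℤ, IsClosed (Set.range (X.d k : X.V k → W (k + 1)))

/-- The cocycles `ℨ^k = ker d^k`, as a subspace of `W^k`. -/
def cocycles (X : HilbertComplex W) (k : ℤ) : Submodule ℝ (W k) :=
  (LinearMap.ker (X.d k).toFun).map (X.V k).subtype

/-- The coboundaries `𝔅^{k+1} = d^k V^k`, as a subspace of `W^{k+1}`. -/
def coboundaries (X : HilbertComplex W) (k : ℤ) : Submodule ℝ (W (k + 1)) :=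
  LinearMap.range (X.d k).toFun

/-- The harmonic space `ℌ^{k+1} = ℨ^{k+1} ∩ (𝔅^{k+1})^⊥`, as a subspace of `W^{k+1}`.
(Every degree in `ℤ` is of the form `k + 1`.) -/
noncomputable def harmonic (X : HilbertComplex W) (k : ℤ) : Submodule ℝ (W (k + 1)) :=
  X.cocycles (k + 1) ⊓ (X.coboundaries k)ᗮ

theorem harmonic_le_V (X : HilbertComplex W) (k : ℤ) : X.harmonic k ≤ X.V (k + 1) :=
  fun _ hx => Submodule.map_subtype_le _ _ hx.1

/-- The inclusion `ℌ^{k+1} ⊆ V^{k+1}`. -/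
noncomputable def harmonicToV (X : HilbertComplex W) (k : ℤ) : X.harmonic k →ₗ[ℝ] X.V (k + 1) :=
  Submodule.inclusion (X.harmonic_le_V k)

/-- `c` is a constant for the Poincaré inequality in degree `k`:
`‖v‖_V ≤ c ‖d^k v‖` for all `v ∈ V^k` that are orthogonal to the cocycles `ℨ^k`. -/
def IsPoincareConstant (X : HilbertComplex W) (k : ℤ) (c : ℝ) : Prop :=
  ∀ v : X.V k, (v : W k) ∈ (X.cocycles k)ᗮ → X.normV v ≤ c * ‖X.d k v‖

/-- A nonlinear operator `F : V^k → W^k` is monotone: `⟨F u - F v, u - v⟩ ≥ 0`. -/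
def IsMonotone (X : HilbertComplex W) {k : ℤ} (F : X.V k → W k) : Prop :=
  ∀ u v : X.V k, 0 ≤ ⟪F u - F v, (u : W k) - (v : W k)⟫_ℝ

/-- `F : V^k → W^k` is Lipschitz with respect to the `V`-norm with constant `L`:
`‖F u - F v‖ ≤ L ‖u - v‖_V`. -/
def IsLipschitzV (X : HilbertComplex W) {k : ℤ} (L : ℝ) (F : X.V k → W k) : Prop :=
  ∀ u v : X.V k, ‖F u - F v‖ ≤ L * X.normV (u - v)

/-- `(σ, u, p) ∈ V^k × V^{k+1} × ℌ^{k+1}` solves the mixed semilinear problem in degree `k + 1`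
with right-hand side `f ∈ W^{k+1}`. -/
structure IsMixedSolution (X : HilbertComplex W) {k : ℤ} (F : X.V (k + 1) → W (k + 1))
    (f : W (k + 1)) (σ : X.V k) (u : X.V (k + 1)) (p : X.harmonic k) : Prop where
  eq_sigma : ∀ τ : X.V k, ⟪(σ : W k), (τ : W k)⟫_ℝ - ⟪(u : W (k + 1)), X.d k τ⟫_ℝ = 0
  eq_u : ∀ v : X.V (k + 1),
    ⟪X.d k σ, (v : W (k + 1))⟫_ℝ + ⟪X.d (k + 1) u, X.d (k + 1) v⟫_ℝ
      + ⟪(p : W (k + 1)), (v : W (k + 1))⟫_ℝ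
      + ⟪F (u + X.harmonicToV k p), (v : W (k + 1))⟫_ℝ = ⟪f, (v : W (k + 1))⟫_ℝ
  eq_p : ∀ q : X.harmonic k, ⟪(u : W (k + 1)), (q : W (k + 1))⟫_ℝ = 0

end HilbertComplex

/-!
Let `R` and `S` be the pseudoinverses of the differentials out of degrees `k` and `k + 1`: they
invert `d` on the orthogonal complement of the cocycles and vanish on the orthogonal complement of
the coboundaries. Both are bounded, by the open mapping theorem, because the differentials are
closed with closed range (`IsClosedComplex.exists_isPseudoinverse`); this is the Poincaré
inequality. They also give the Hodge decomposition `v = d R v + h + S d v` with `h` harmonic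
(`IsPseudoinverse.hodge`).

Existence. With `w = u + p` and `g = f - F w`, the Hodge decomposition turns the mixed problem into
`σ = R g`, `p = P g` and `d u = S† g`, where `P` is the projection onto the harmonic space, and
`w = R† σ + p + S (d u)`. Hence `z = (σ, p, d u)`, in the Hilbert product of the three spaces,
solves the Hammerstein equation `z = T† (f - F (T z))` with `T (σ, p, ω) = R† σ + p + S ω`. The
operator `T` is bounded into the graph norm, so `T† ∘ F ∘ T` is Lipschitz; it inherits monotonicity
from `F`. The identity plus a monotone Lipschitz map is onto, by a contraction argument
(`exists_add_eq_of_monotone_lipschitz`).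

Stability. Testing the difference of two problems with the difference of the `u + p`, monotonicity
bounds the sum of the squares of `‖σ - σ'‖`, `‖d (u - u')‖` and `‖p - p'‖` by
`‖f - f'‖ ‖(u + p) - (u' + p')‖`, and the Poincaré inequality bounds the last factor by those three
norms. Testing with `d (σ - σ')` and using the Lipschitz condition bounds `‖d (σ - σ')‖`
(`IsClosedComplex.isMixedSolution_sub_le`). Uniqueness is the case `f = f'`.
-/

/-! ### Monotone Lipschitz equations in a Hilbert space -/

/-- The identity plus a monotone Lipschitz map is onto: the damped iteration
`z ↦ z - ρ (z + G z - b)` is a contraction for `ρ = 1 / (1 + M ^ 2)`. -/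
theorem exists_add_eq_of_monotone_lipschitz {Y : Type*} [NormedAddCommGroup Y]
    [InnerProductSpace ℝ Y] [CompleteSpace Y] (G : Y → Y) (M : ℝ)
    (hmono : ∀ x y, 0 ≤ ⟪G x - G y, x - y⟫_ℝ) (hlip : ∀ x y, ‖G x - G y‖ ≤ M * ‖x - y‖) (b : Y) :
    ∃ z, z + G z = b := by
  set ρ : ℝ := 1 / (1 + M ^ 2) with hρ
  have hM : 0 < 1 + M ^ 2 := by positivity
  have hρ0 : 0 < ρ := by positivity
  have hρ1 : ρ ≤ 1 := by
    rw [hρ, div_le_one hM]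
    nlinarith [sq_nonneg M]
  have hρM : ρ * (1 + M ^ 2) = 1 := by
    rw [hρ]
    field_simp
  have hcontr : ContractingWith (Real.sqrt (1 - ρ)).toNNReal
      (fun z => z - ρ • (z + G z - b)) := by
    refine ⟨?_, LipschitzWith.of_dist_le_mul fun x y => ?_⟩
    · rw [Real.toNNReal_lt_one, Real.sqrt_lt' one_pos]
      linarith
    · rw [Real.coe_toNNReal _ (Real.sqrt_nonneg _), dist_eq_norm, dist_eq_norm]
      have hsub : x - ρ • (x + G x - b) - (y - ρ • (y + G y - b))
          = (1 - ρ) • (x - y) - ρ • (G x - G y) := by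
        module
      rw [hsub]
      refine abs_le_of_sq_le_sq' ?_ (by positivity) |>.2
      rw [mul_pow, Real.sq_sqrt (by linarith), norm_sub_sq_real, norm_smul, norm_smul,
        inner_smul_left, inner_smul_right, real_inner_comm]
      simp only [Real.norm_eq_abs, mul_pow, sq_abs, conj_trivial]
      have h1 := mul_nonneg (mul_nonneg hρ0.le (sub_nonneg.2 hρ1)) (hmono x y)
      have h2 : ‖G x - G y‖ ^ 2 ≤ M ^ 2 * ‖x - y‖ ^ 2 := by
        rw [← mul_pow]
        exact pow_le_pow_left₀ (norm_nonneg _) (hlip x y) 2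
      have h3 := mul_le_mul_of_nonneg_left h2 (sq_nonneg ρ)
      have h4 : (1 - ρ) ^ 2 + ρ ^ 2 * M ^ 2 = 1 - ρ := by
        linear_combination ρ * hρM
      have h5 : ((1 - ρ) ^ 2 + ρ ^ 2 * M ^ 2) * ‖x - y‖ ^ 2 = (1 - ρ) * ‖x - y‖ ^ 2 := by rw [h4]
      linarith
  have hfix : _ - _ = _ := hcontr.fixedPoint_isFixedPt
  refine ⟨ContractingWith.fixedPoint _ hcontr, ?_⟩
  rw [sub_eq_self, smul_eq_zero_iff_right hρ0.ne', sub_eq_zero] at hfix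
  exact hfix

/-- Weak solvability of the Hammerstein equation `z = T† (f - G z)` when `T† ∘ G` is monotone. -/
theorem exists_weak_hammerstein {Y E : Type*} [NormedAddCommGroup Y] [InnerProductSpace ℝ Y]
    [CompleteSpace Y] [NormedAddCommGroup E] [InnerProductSpace ℝ E] [CompleteSpace E]
    (T : Y →L[ℝ] E) (G : Y → E) (M : ℝ) (hmono : ∀ x y, 0 ≤ ⟪G x - G y, T (x - y)⟫_ℝ)
    (hlip : ∀ x y, ‖G x - G y‖ ≤ M * ‖x - y‖) (f : E) :
    ∃ z, ∀ y, ⟪z, y⟫_ℝ = ⟪f - G z, T y⟫_ℝ := by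
  obtain ⟨z, hz⟩ := exists_add_eq_of_monotone_lipschitz
    (fun z => T.adjoint (G z)) (‖T.adjoint‖ * M)
    (fun x y => by
      rw [← map_sub, ContinuousLinearMap.adjoint_inner_left]
      exact hmono x y)
    (fun x y => by
      rw [← map_sub, mul_assoc]
      exact T.adjoint.le_opNorm_of_le (hlip x y)) (T.adjoint f)
  refine ⟨z, fun y => ?_⟩
  rw [← ContinuousLinearMap.adjoint_inner_left, map_sub, ← hz, add_sub_cancel_right]

namespace HilbertComplex

variable {W : ℤ → Type u} [∀ k, NormedAddCommGroup (W k)]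
    [∀ k, InnerProductSpace ℝ (W k)] [∀ k, CompleteSpace (W k)]

/-! ### The graph norm -/

theorem normV_sq (X : HilbertComplex W) {k : ℤ} (v : X.V k) :
    X.normV v ^ 2 = ‖(v : W k)‖ ^ 2 + ‖X.d k v‖ ^ 2 := by
  have h : X.innerV v v = ‖(v : W k)‖ ^ 2 + ‖X.d k v‖ ^ 2 := by
    simp [innerV]
  rw [normV, h, Real.sq_sqrt (by positivity)]

theorem normV_nonneg (X : HilbertComplex W) {k : ℤ} (v : X.V k) : 0 ≤ X.normV v :=
  Real.sqrt_nonneg _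

theorem norm_le_normV (X : HilbertComplex W) {k : ℤ} (v : X.V k) : ‖(v : W k)‖ ≤ X.normV v := by
  refine (abs_le_of_sq_le_sq' ?_ (X.normV_nonneg v)).2
  rw [normV_sq]
  exact le_add_of_nonneg_right (sq_nonneg _)

theorem normV_le (X : HilbertComplex W) {k : ℤ} (v : X.V k) :
    X.normV v ≤ ‖(v : W k)‖ + ‖X.d k v‖ := by
  refine (abs_le_of_sq_le_sq' ?_ (by positivity)).2
  rw [normV_sq]
  nlinarith [norm_nonneg (v : W k), norm_nonneg (X.d k v)]

theorem eq_of_normV_sub_eq_zero (X : HilbertComplex W) {k : ℤ} {u v : X.V k}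
    (h : X.normV (u - v) = 0) : u = v := by
  have h1 := X.norm_le_normV (u - v)
  rw [h, norm_le_zero_iff, ZeroMemClass.coe_eq_zero] at h1
  exact sub_eq_zero.1 h1

/-! ### Cocycles, coboundaries and harmonic elements -/

theorem mem_cocycles (X : HilbertComplex W) {k : ℤ} {x : W k} :
    x ∈ X.cocycles k ↔ ∃ h : x ∈ X.V k, X.d k ⟨x, h⟩ = 0 := by
  constructor
  · rintro ⟨v, hv, rfl⟩
    exact ⟨v.2, hv⟩
  · rintro ⟨h, h0⟩
    exact ⟨⟨x, h⟩, h0, rfl⟩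

theorem coe_mem_cocycles (X : HilbertComplex W) {k : ℤ} {v : X.V k} :
    (v : W k) ∈ X.cocycles k ↔ X.d k v = 0 := by
  rw [mem_cocycles]
  exact ⟨fun ⟨_, h⟩ => h, fun h => ⟨v.2, h⟩⟩

theorem d_mem_coboundaries (X : HilbertComplex W) {k : ℤ} (v : X.V k) :
    X.d k v ∈ X.coboundaries k :=
  ⟨v, rfl⟩

theorem coboundaries_le_cocycles (X : HilbertComplex W) (k : ℤ) :
    X.coboundaries k ≤ X.cocycles (k + 1) := by
  rintro _ ⟨v, rfl⟩
  exact X.mem_cocycles.2 ⟨X.d_mem_domain k v, X.d_comp_d k v⟩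

theorem isClosed_cocycles (X : HilbertComplex W) (k : ℤ) :
    IsClosed (X.cocycles k : Set (W k)) := by
  have h : (X.cocycles k : Set (W k)) =
      (fun x : W k => (x, (0 : W (k + 1)))) ⁻¹' ((X.d k).graph : Set (W k × W (k + 1))) := by
    ext x
    simp only [SetLike.mem_coe, Set.mem_preimage, LinearPMap.mem_graph_iff, mem_cocycles]
    constructor
    · rintro ⟨h, h0⟩
      exact ⟨⟨x, h⟩, rfl, h0⟩
    · rintro ⟨y, rfl, h0⟩
      exact ⟨y.2, h0⟩
  rw [h]
  exact (X.isClosed_d k).preimage (by fun_prop)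

theorem isClosed_harmonic (X : HilbertComplex W) (k : ℤ) :
    IsClosed (X.harmonic k : Set (W (k + 1))) :=
  (X.isClosed_cocycles (k + 1)).inter (Submodule.isClosed_orthogonal _)

theorem inner_harmonic_d (X : HilbertComplex W) {k : ℤ} (q : X.harmonic k) (τ : X.V k) :
    ⟪(q : W (k + 1)), X.d k τ⟫_ℝ = 0 :=
  (Submodule.mem_orthogonal' _ _).1 q.2.2 _ (X.d_mem_coboundaries τ)

theorem d_harmonicToV (X : HilbertComplex W) {k : ℤ} (q : X.harmonic k) :
    X.d (k + 1) (X.harmonicToV k q) = 0 :=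
  X.coe_mem_cocycles.1 q.2.1

theorem coe_harmonicToV (X : HilbertComplex W) {k : ℤ} (q : X.harmonic k) :
    (X.harmonicToV k q : W (k + 1)) = q :=
  rfl

/-! ### The bounded pseudoinverse of the differential and the Hodge decomposition -/

/-- `R` is the pseudoinverse of `d^k`: it takes values in `V^k ∩ ℨ^{k⊥}`, and `d R` is the
orthogonal projection onto the coboundaries. The projection property is stated weakly, by testing
against the coboundaries `d τ`. -/
structure IsPseudoinverse (X : HilbertComplex W) (k : ℤ) (R : W (k + 1) →L[ℝ] W k) : Prop where
  mem : ∀ g, R g ∈ X.V k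
  mem_orthogonal : ∀ g, R g ∈ (X.cocycles k)ᗮ
  inner_d : ∀ (g : W (k + 1)) (τ : X.V k), ⟪X.d k ⟨R g, mem g⟩, X.d k τ⟫_ℝ = ⟪g, X.d k τ⟫_ℝ

/-- The pseudoinverse of a closed operator with closed range is bounded, by the open mapping theorem
applied to the graph of `d^k` over `ℨ^{k⊥}`. -/
theorem IsClosedComplex.exists_isPseudoinverse {X : HilbertComplex W} (hX : X.IsClosedComplex)
    (k : ℤ) : ∃ R, X.IsPseudoinverse k R := by
  have hB : IsClosed (X.coboundaries k : Set (W (k + 1))) := hX k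
  have : CompleteSpace (X.coboundaries k) := hB.completeSpace_coe
  have : CompleteSpace (X.cocycles k) := (X.isClosed_cocycles k).completeSpace_coe
  let N : Submodule ℝ (W k × W (k + 1)) :=
    (X.d k).graph ⊓ (X.cocycles k)ᗮ.comap (LinearMap.fst ℝ _ _)
  have hN : IsClosed (N : Set (W k × W (k + 1))) :=
    (X.isClosed_d k).inter ((Submodule.isClosed_orthogonal _).preimage continuous_fst)
  have : CompleteSpace N := hN.completeSpace_coe
  have hmem : ∀ x : N, ∃ v : X.V k, (v : W k) = x.1.1 ∧ X.d k v = x.1.2 := fun x =>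
    LinearPMap.mem_graph_iff _ |>.1 x.2.1
  let e₀ : N →L[ℝ] X.coboundaries k :=
    ((ContinuousLinearMap.snd ℝ _ _).comp N.subtypeL).codRestrict _ fun x => by
      obtain ⟨v, -, hv⟩ := hmem x
      exact ⟨v, hv⟩
  have hker : e₀.ker = ⊥ := by
    refine LinearMap.ker_eq_bot'.2 fun x hx => ?_
    have hx2 : x.1.2 = 0 := congrArg Subtype.val hx
    obtain ⟨v, hv1, hv2⟩ := hmem x
    have hz : x.1.1 ∈ X.cocycles k := by
      rw [← hv1, coe_mem_cocycles, hv2, hx2]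
    have h0 : x.1.1 = 0 :=
      inner_self_eq_zero.1 ((Submodule.mem_orthogonal _ _).1 x.2.2 _ hz)
    exact Subtype.ext (Prod.ext h0 hx2)
  have hrange : e₀.range = ⊤ := by
    refine LinearMap.range_eq_top.2 ?_
    rintro ⟨_, v, rfl⟩
    obtain ⟨z, hz, y, hy, hzy⟩ := (X.cocycles k).exists_add_mem_mem_orthogonal (v : W k)
    obtain ⟨hzV, hz0⟩ := X.mem_cocycles.1 hz
    have hy' : y = ((v - ⟨z, hzV⟩ : X.V k) : W k) := by
      rw [Submodule.coe_sub, hzy]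
      simp
    have hd : X.d k (v - ⟨z, hzV⟩) = X.d k v := by
      rw [LinearPMap.map_sub, hz0, sub_zero]
    exact ⟨⟨(y, X.d k v), (LinearPMap.mem_graph_iff _).2 ⟨_, hy'.symm, hd⟩, hy⟩, rfl⟩
  let e := ContinuousLinearEquiv.ofBijective e₀ hker hrange
  let R : W (k + 1) →L[ℝ] W k := (ContinuousLinearMap.fst ℝ _ _).comp
    (N.subtypeL.comp ((e.symm : X.coboundaries k →L[ℝ] N).comp
      (X.coboundaries k).orthogonalProjectionOnto))
  have hR : ∀ g, ∃ h : R g ∈ X.V k,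
      X.d k ⟨R g, h⟩ = (X.coboundaries k).orthogonalProjectionOnto g := fun g => by
    set x := e.symm ((X.coboundaries k).orthogonalProjectionOnto g) with hx
    obtain ⟨v, hv1, hv2⟩ := hmem x
    have hRv : R g = v := hv1.symm
    have he : e x = (X.coboundaries k).orthogonalProjectionOnto g := e.apply_symm_apply _
    have he' : x.1.2 = (X.coboundaries k).orthogonalProjectionOnto g := congrArg Subtype.val he
    refine ⟨hRv ▸ v.2, ?_⟩
    rw [← he', ← hv2]
    congr 1
    exact Subtype.ext hRv
  refine ⟨R, fun g => (hR g).1, fun g => (e.symm _).2.2, fun g τ => ?_⟩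
  rw [(hR g).2, ← sub_eq_zero, ← inner_sub_left, ← neg_sub g, inner_neg_left, neg_eq_zero]
  exact (Submodule.mem_orthogonal' _ _).1
    ((X.coboundaries k).sub_starProjection_mem_orthogonal g) _ (X.d_mem_coboundaries τ)

namespace IsPseudoinverse

variable {X : HilbertComplex W} {k : ℤ} {R : W (k + 1) →L[ℝ] W k}

/-- The values of a pseudoinverse, as elements of `V^k`. -/
def lift (hR : X.IsPseudoinverse k R) (g : W (k + 1)) : X.V k :=
  ⟨R g, hR.mem g⟩

theorem coe_lift (hR : X.IsPseudoinverse k R) (g : W (k + 1)) : (hR.lift g : W k) = R g :=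
  rfl

theorem inner_d_lift (hR : X.IsPseudoinverse k R) (g : W (k + 1)) (τ : X.V k) :
    ⟪X.d k (hR.lift g), X.d k τ⟫_ℝ = ⟪g, X.d k τ⟫_ℝ :=
  hR.inner_d g τ

theorem inner_d_lift' (hR : X.IsPseudoinverse k R) (g : W (k + 1)) (τ : X.V k) :
    ⟪X.d k τ, X.d k (hR.lift g)⟫_ℝ = ⟪X.d k τ, g⟫_ℝ := by
  rw [real_inner_comm, hR.inner_d_lift, real_inner_comm]

theorem inner_cocycle (hR : X.IsPseudoinverse k R) (g : W (k + 1)) {z : W k}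
    (hz : z ∈ X.cocycles k) : ⟪R g, z⟫_ℝ = 0 :=
  (Submodule.mem_orthogonal' _ _).1 (hR.mem_orthogonal g) _ hz

theorem norm_d_lift_le (hR : X.IsPseudoinverse k R) (g : W (k + 1)) :
    ‖X.d k (hR.lift g)‖ ≤ ‖g‖ := by
  have h := hR.inner_d_lift g (hR.lift g)
  rw [real_inner_self_eq_norm_mul_norm] at h
  have h2 := real_inner_le_norm g (X.d k (hR.lift g))
  rw [← h] at h2
  by_contra! hlt
  have hpos := (norm_nonneg g).trans_lt hlt
  exact absurd h2 (not_le.2 (mul_lt_mul_of_pos_right hlt hpos))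

theorem d_lift_d (hR : X.IsPseudoinverse k R) (v : X.V k) :
    X.d k (hR.lift (X.d k v)) = X.d k v := by
  rw [← sub_eq_zero, ← inner_self_eq_zero (𝕜 := ℝ), inner_sub_left, ← LinearPMap.map_sub,
    hR.inner_d_lift, sub_self]

theorem sub_lift_d_mem_cocycles (hR : X.IsPseudoinverse k R) (v : X.V k) :
    (v : W k) - R (X.d k v) ∈ X.cocycles k :=
  X.coe_mem_cocycles (v := v - hR.lift (X.d k v)).2 <| by
    rw [LinearPMap.map_sub, hR.d_lift_d, sub_self]

theorem inner_lift_eq (hR : X.IsPseudoinverse k R) (g : W (k + 1)) (v : X.V k) :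
    ⟪R g, R (X.d k v)⟫_ℝ = ⟪R g, (v : W k)⟫_ℝ := by
  have h := hR.inner_cocycle g (hR.sub_lift_d_mem_cocycles v)
  rw [inner_sub_right] at h
  linarith

theorem apply_d_of_mem_orthogonal (hR : X.IsPseudoinverse k R) {v : X.V k}
    (hv : (v : W k) ∈ (X.cocycles k)ᗮ) : R (X.d k v) = v := by
  have h := (X.cocycles k).inner_right_of_mem_orthogonal (hR.sub_lift_d_mem_cocycles v)
    (Submodule.sub_mem _ hv (hR.mem_orthogonal (X.d k v)))
  exact (sub_eq_zero.1 (inner_self_eq_zero.1 h)).symm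

theorem apply_of_mem_orthogonal_coboundaries (hR : X.IsPseudoinverse k R) {b : W (k + 1)}
    (hb : b ∈ (X.coboundaries k)ᗮ) : R b = 0 := by
  have h : ⟪X.d k (hR.lift b), X.d k (hR.lift b)⟫_ℝ = 0 := by
    rw [hR.inner_d_lift]
    exact (Submodule.mem_orthogonal' _ _).1 hb _ (X.d_mem_coboundaries _)
  exact inner_self_eq_zero.1
    (hR.inner_cocycle b (X.coe_mem_cocycles (v := hR.lift b).2 (inner_self_eq_zero.1 h)))

/-- The adjoint of the pseudoinverse takes values in the (closed) space of coboundaries. -/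
theorem adjoint_apply_mem_coboundaries (hR : X.IsPseudoinverse k R) (hX : X.IsClosedComplex)
    (y : W k) : R.adjoint y ∈ X.coboundaries k := by
  have hB : IsClosed (X.coboundaries k : Set (W (k + 1))) := hX k
  have : CompleteSpace (X.coboundaries k) := hB.completeSpace_coe
  rw [← (X.coboundaries k).orthogonal_orthogonal, Submodule.mem_orthogonal']
  intro b hb
  rw [ContinuousLinearMap.adjoint_inner_left, hR.apply_of_mem_orthogonal_coboundaries hb,
    inner_zero_right]

theorem isPoincareConstant (hR : X.IsPseudoinverse k R) : X.IsPoincareConstant k (‖R‖ + 1) := by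
  intro v hv
  have h := R.le_opNorm (X.d k v)
  rw [hR.apply_d_of_mem_orthogonal hv] at h
  linarith [X.normV_le v]

theorem norm_apply_d_le (hR : X.IsPseudoinverse k R) {c : ℝ} (hc : X.IsPoincareConstant k c)
    (v : X.V k) : ‖R (X.d k v)‖ ≤ |c| * ‖X.d k v‖ := by
  have h := hc (hR.lift (X.d k v)) (hR.mem_orthogonal _)
  rw [hR.d_lift_d] at h
  calc ‖R (X.d k v)‖ ≤ X.normV (hR.lift (X.d k v)) := X.norm_le_normV (hR.lift (X.d k v))
    _ ≤ c * ‖X.d k v‖ := h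
    _ ≤ |c| * ‖X.d k v‖ := by gcongr; exact le_abs_self c

/-- The Hodge decomposition of `V^{k+1}`: subtracting from `v` its components `d R v` along the
coboundaries and `S d v` along `ℨ^⊥` leaves a harmonic element. -/
theorem hodge (hR : X.IsPseudoinverse k R) {S : W (k + 1 + 1) →L[ℝ] W (k + 1)}
    (hS : X.IsPseudoinverse (k + 1) S) (v : X.V (k + 1)) :
    (v : W (k + 1)) - S (X.d (k + 1) v) - X.d k (hR.lift v) ∈ X.harmonic k := by
  refine ⟨Submodule.sub_mem _ (hS.sub_lift_d_mem_cocycles v)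
    (X.coboundaries_le_cocycles k (X.d_mem_coboundaries _)), ?_⟩
  refine (Submodule.mem_orthogonal' _ _).2 ?_
  rintro _ ⟨τ, rfl⟩
  change ⟪_, X.d k τ⟫_ℝ = 0
  rw [inner_sub_left, inner_sub_left, hR.inner_d_lift,
    hS.inner_cocycle _ (X.coboundaries_le_cocycles k (X.d_mem_coboundaries τ))]
  ring

end IsPseudoinverse

/-! ### Existence -/

/-- The unknowns `(σ, p, du)` of the mixed problem form a Hilbert space, on which the problem is
the Hammerstein equation with `T (σ, p, ω) = R† σ + p + S ω`. -/
theorem IsClosedComplex.exists_isMixedSolution {X : HilbertComplex W} (hX : X.IsClosedComplex)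
    {k : ℤ} {F : X.V (k + 1) → W (k + 1)} (hF : X.IsMonotone F) {L : ℝ} (hL : X.IsLipschitzV L F)
    (f : W (k + 1)) : ∃ σ u p, X.IsMixedSolution F f σ u p := by
  obtain ⟨R, hR⟩ := hX.exists_isPseudoinverse k
  obtain ⟨S, hS⟩ := hX.exists_isPseudoinverse (k + 1)
  have : CompleteSpace (X.harmonic k) := (X.isClosed_harmonic k).completeSpace_coe
  let Y := WithLp 2 (W k × WithLp 2 (X.harmonic k × W (k + 1 + 1)))
  let T : Y →L[ℝ] W (k + 1) :=
    R.adjoint.comp (WithLp.fstL 2 ℝ _ _) +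
      ((X.harmonic k).subtypeL.comp (WithLp.fstL 2 ℝ _ _) + S.comp (WithLp.sndL 2 ℝ _ _)).comp
        (WithLp.sndL 2 ℝ _ _)
  have hT : ∀ y : Y, T y = R.adjoint y.fst + ((y.snd.fst : W (k + 1)) + S y.snd.snd) := fun _ => rfl
  have hinner : ∀ x y : Y, ⟪x, y⟫_ℝ =
      ⟪x.fst, y.fst⟫_ℝ + (⟪x.snd.fst, y.snd.fst⟫_ℝ + ⟪x.snd.snd, y.snd.snd⟫_ℝ) := fun _ _ => rfl
  have hB : ∀ y, ∃ h : R.adjoint y ∈ X.V (k + 1), X.d (k + 1) ⟨R.adjoint y, h⟩ = 0 := fun y =>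
    X.mem_cocycles.1 (X.coboundaries_le_cocycles k (hR.adjoint_apply_mem_coboundaries hX y))
  let U : W k → W (k + 1 + 1) → X.V (k + 1) := fun y z => ⟨R.adjoint y, (hB y).1⟩ + hS.lift z
  have hU : ∀ y z, (U y z : W (k + 1)) = R.adjoint y + S z := fun _ _ => rfl
  have hdU : ∀ y z, X.d (k + 1) (U y z) = X.d (k + 1) (hS.lift z) := fun y z => by
    rw [LinearPMap.map_add, (hB y).2, zero_add]
  let TV : Y → X.V (k + 1) := fun y => U y.fst y.snd.snd + X.harmonicToV k y.snd.fst
  have hTV : ∀ y, (TV y : W (k + 1)) = T y := fun y => by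
    change R.adjoint y.fst + S y.snd.snd + (y.snd.fst : W (k + 1)) = _
    rw [hT]
    abel
  have hdTV : ∀ y, X.d (k + 1) (TV y) = X.d (k + 1) (hS.lift y.snd.snd) := fun y => by
    rw [LinearPMap.map_add, hdU, d_harmonicToV, add_zero]
  have hTVsub : ∀ x y, TV x - TV y = TV (x - y) := fun x y => Subtype.ext <| by
    rw [Submodule.coe_sub, hTV, hTV, hTV, map_sub]
  have hTVnorm : ∀ y, X.normV (TV y) ≤ (‖T‖ + 1) * ‖y‖ := fun y => by
    have h1 := T.le_opNorm y
    have h2 : ‖y.snd.snd‖ ≤ ‖y‖ := (WithLp.norm_snd_le _ y.snd).trans (WithLp.norm_snd_le _ y)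
    have h3 := X.normV_le (TV y)
    rw [hTV, hdTV] at h3
    linarith [hS.norm_d_lift_le y.snd.snd]
  obtain ⟨z, hz⟩ := exists_weak_hammerstein T (fun y => F (TV y)) (|L| * (‖T‖ + 1))
    (fun x y => by
      have h := hF (TV x) (TV y)
      rwa [hTV, hTV, ← map_sub] at h)
    (fun x y => by
      refine (hL (TV x) (TV y)).trans ?_
      rw [hTVsub, mul_assoc]
      exact mul_le_mul (le_abs_self L) (hTVnorm _) (X.normV_nonneg _) (abs_nonneg L)) f
  set g := f - F (TV z) with hg
  have hσ : z.fst = R g := by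
    refine ext_inner_right ℝ fun y => ?_
    have h := hz (WithLp.toLp 2 (y, 0))
    simpa [hT, hinner, ContinuousLinearMap.adjoint_inner_right] using h
  have hp : ∀ q : X.harmonic k, ⟪(z.snd.fst : W (k + 1)), (q : W (k + 1))⟫_ℝ
      = ⟪g, (q : W (k + 1))⟫_ℝ := fun q => by
    have h := hz (WithLp.toLp 2 (0, WithLp.toLp 2 (q, 0)))
    simpa [hT, hinner] using h
  have hω : ∀ y, ⟪z.snd.snd, y⟫_ℝ = ⟪g, S y⟫_ℝ := fun y => by
    have h := hz (WithLp.toLp 2 (0, WithLp.toLp 2 (0, y)))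
    simpa [hT, hinner] using h
  refine ⟨hR.lift g, U z.fst z.snd.snd, z.snd.fst, ⟨fun τ => ?_, fun v => ?_, fun q => ?_⟩⟩
  · rw [hU, hR.coe_lift, inner_add_left, ContinuousLinearMap.adjoint_inner_left, hσ,
      hS.inner_cocycle _ (X.coboundaries_le_cocycles k (X.d_mem_coboundaries τ)),
      hR.inner_lift_eq]
    ring
  · have hFz : ⟪F (U z.fst z.snd.snd + X.harmonicToV k z.snd.fst), (v : W (k + 1))⟫_ℝ
        = ⟪f, (v : W (k + 1))⟫_ℝ - ⟪g, (v : W (k + 1))⟫_ℝ := by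
      rw [← inner_sub_left, hg, sub_sub_cancel]
    -- Each of the three linear terms tests `g` against one Hodge component of `v`.
    set h : X.harmonic k := ⟨_, hR.hodge hS v⟩
    have hv : (h : W (k + 1)) = v - S (X.d (k + 1) v) - X.d k (hR.lift v) := rfl
    have hσv : ⟪X.d k (hR.lift g), (v : W (k + 1))⟫_ℝ = ⟪g, X.d k (hR.lift v)⟫_ℝ := by
      rw [← hR.inner_d_lift', hR.inner_d_lift]
    have huv : ⟪X.d (k + 1) (U z.fst z.snd.snd), X.d (k + 1) v⟫_ℝ = ⟪g, S (X.d (k + 1) v)⟫_ℝ := by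
      rw [hdU, hS.inner_d_lift, hω]
    have hpv : ⟪(z.snd.fst : W (k + 1)), (v : W (k + 1))⟫_ℝ = ⟪g, (h : W (k + 1))⟫_ℝ := by
      rw [← hp h, hv, inner_sub_right, inner_sub_right, inner_harmonic_d, real_inner_comm (S _),
        hS.inner_cocycle _ z.snd.fst.2.1]
      ring
    rw [hFz, hσv, huv, hpv, hv, inner_sub_right, inner_sub_right]
    ring
  · rw [hU, inner_add_left, hS.inner_cocycle _ q.2.1, real_inner_comm,
      (Submodule.mem_orthogonal' _ _).1 q.2.2 _ (hR.adjoint_apply_mem_coboundaries hX _), add_zero]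

/-! ### Lipschitz dependence on the data and uniqueness -/

/-- The difference of the two problems is tested with the difference of `u + p`, where monotonicity
allows the nonlinear term to be dropped, and with that of `d σ`, where the Lipschitz condition
bounds it. Absolute values appear because `c` and `L` are not assumed nonnegative: negative values
are admissible when the spaces involved are trivial. -/
theorem IsClosedComplex.isMixedSolution_sub_le {X : HilbertComplex W} (hX : X.IsClosedComplex)
    {k : ℤ} {F : X.V (k + 1) → W (k + 1)} (hF : X.IsMonotone F) {L : ℝ} (hL : X.IsLipschitzV L F)
    {c : ℝ} (hc : X.IsPoincareConstant k c) (hc' : X.IsPoincareConstant (k + 1) c)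
    {f f' : W (k + 1)} {σ σ' : X.V k} {u u' : X.V (k + 1)} {p p' : X.harmonic k}
    (h : X.IsMixedSolution F f σ u p) (h' : X.IsMixedSolution F f' σ' u' p') :
    X.normV (σ - σ') + X.normV (u - u') + ‖p - p'‖ ≤
      ((2 * |c| + 3 + |L| * (2 * |c| + 2)) * (2 * |c| + 1) + 1) * ‖f - f'‖ := by
  obtain ⟨R, hR⟩ := hX.exists_isPseudoinverse k
  obtain ⟨S, hS⟩ := hX.exists_isPseudoinverse (k + 1)
  set Φ := F (u + X.harmonicToV k p) - F (u' + X.harmonicToV k p') with hΦ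
  set g := f - f' with hg
  set a := σ - σ' with ha
  set b := u - u' with hb
  set q := p - p' with hq
  have hbq : (u + X.harmonicToV k p) - (u' + X.harmonicToV k p') = b + X.harmonicToV k q := by
    rw [hb, hq, map_sub]
    abel
  have e1 : ∀ τ : X.V k, ⟪(a : W k), (τ : W k)⟫_ℝ = ⟪(b : W (k + 1)), X.d k τ⟫_ℝ := fun τ => by
    rw [ha, hb, Submodule.coe_sub, Submodule.coe_sub, inner_sub_left, inner_sub_left]
    linarith [h.eq_sigma τ, h'.eq_sigma τ]
  have e2 : ∀ v : X.V (k + 1), ⟪X.d k a, (v : W (k + 1))⟫_ℝ + ⟪X.d (k + 1) b, X.d (k + 1) v⟫_ℝ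
      + ⟪(q : W (k + 1)), (v : W (k + 1))⟫_ℝ + ⟪Φ, (v : W (k + 1))⟫_ℝ
      = ⟪g, (v : W (k + 1))⟫_ℝ := fun v => by
    rw [ha, hb, hq, hΦ, hg, LinearPMap.map_sub, LinearPMap.map_sub, Submodule.coe_sub,
      inner_sub_left, inner_sub_left, inner_sub_left, inner_sub_left, inner_sub_left]
    linarith [h.eq_u v, h'.eq_u v]
  have e3 : ∀ r : X.harmonic k, ⟪(b : W (k + 1)), (r : W (k + 1))⟫_ℝ = 0 := fun r => by
    rw [hb, Submodule.coe_sub, inner_sub_left, h.eq_p, h'.eq_p, sub_zero]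
  have hΦ0 : 0 ≤ ⟪Φ, ((b + X.harmonicToV k q : X.V (k + 1)) : W (k + 1))⟫_ℝ := by
    rw [← hbq]
    exact hF _ _
  have henergy : ‖(a : W k)‖ ^ 2 + ‖X.d (k + 1) b‖ ^ 2 + ‖q‖ ^ 2
      ≤ ‖g‖ * ‖(b : W (k + 1)) + q‖ := by
    have h2 := e2 (b + X.harmonicToV k q)
    have hab : ⟪X.d k a, (b : W (k + 1))⟫_ℝ = ‖(a : W k)‖ ^ 2 := by
      rw [real_inner_comm, ← e1, real_inner_self_eq_norm_sq]
    have haq : ⟪X.d k a, (q : W (k + 1))⟫_ℝ = 0 := by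
      rw [real_inner_comm, inner_harmonic_d]
    have hqb : ⟪(q : W (k + 1)), (b : W (k + 1))⟫_ℝ = 0 := by
      rw [real_inner_comm, e3]
    have hqq : ‖(q : W (k + 1))‖ = ‖q‖ := rfl
    rw [LinearPMap.map_add, d_harmonicToV, add_zero, real_inner_self_eq_norm_sq] at h2
    rw [Submodule.coe_add, coe_harmonicToV] at h2 hΦ0
    rw [inner_add_right (X.d k a), inner_add_right (q : W (k + 1)), hab, haq, hqb,
      real_inner_self_eq_norm_sq, hqq] at h2
    linarith [real_inner_le_norm g ((b : W (k + 1)) + q)]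
  -- `b` has no harmonic component, so it is controlled by `a` and `d b`.
  have hsplit : (b : W (k + 1)) = S (X.d (k + 1) b) + X.d k (hR.lift b) := by
    set r : X.harmonic k := ⟨_, hR.hodge hS b⟩
    have hrv : (r : W (k + 1)) = b - S (X.d (k + 1) b) - X.d k (hR.lift b) := rfl
    have h0 : ⟪(r : W (k + 1)), (r : W (k + 1))⟫_ℝ = 0 := by
      nth_rewrite 1 [hrv]
      rw [inner_sub_left, inner_sub_left, e3, hS.inner_cocycle _ r.2.1, real_inner_comm,
        inner_harmonic_d]
      ring
    have h1 := inner_self_eq_zero.1 h0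
    rw [hrv, sub_sub, sub_eq_zero] at h1
    exact h1
  have hexact : ‖X.d k (hR.lift b)‖ ≤ |c| * ‖(a : W k)‖ := by
    have h1 : ‖X.d k (hR.lift b)‖ * ‖X.d k (hR.lift b)‖
        ≤ ‖(a : W k)‖ * (|c| * ‖X.d k (hR.lift b)‖) := by
      calc ‖X.d k (hR.lift b)‖ * ‖X.d k (hR.lift b)‖ = ⟪(a : W k), R b⟫_ℝ := by
            rw [← real_inner_self_eq_norm_mul_norm, hR.inner_d_lift, ← e1, hR.coe_lift]
        _ ≤ ‖(a : W k)‖ * ‖R b‖ := real_inner_le_norm _ _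
        _ ≤ ‖(a : W k)‖ * (|c| * ‖X.d k (hR.lift b)‖) := by
            have h2 := hR.norm_apply_d_le hc (hR.lift b)
            rw [hR.apply_d_of_mem_orthogonal (hR.mem_orthogonal _), hR.coe_lift] at h2
            gcongr
    rcases (norm_nonneg (X.d k (hR.lift b))).eq_or_lt with h0 | hpos
    · rw [← h0]
      positivity
    · exact le_of_mul_le_mul_right (by linarith) hpos
  -- The energy norm `s` of the difference controls every other quantity.
  set s := Real.sqrt (‖(a : W k)‖ ^ 2 + ‖X.d (k + 1) b‖ ^ 2 + ‖q‖ ^ 2)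
  have hs0 : 0 ≤ s := Real.sqrt_nonneg _
  have hs2 : s ^ 2 = ‖(a : W k)‖ ^ 2 + ‖X.d (k + 1) b‖ ^ 2 + ‖q‖ ^ 2 :=
    Real.sq_sqrt (by positivity)
  have has : ‖(a : W k)‖ ≤ s := Real.le_sqrt_of_sq_le (by nlinarith)
  have hbs : ‖X.d (k + 1) b‖ ≤ s := Real.le_sqrt_of_sq_le (by nlinarith)
  have hqs : ‖q‖ ≤ s := Real.le_sqrt_of_sq_le (by nlinarith)
  have hbn : ‖(b : W (k + 1))‖ ≤ 2 * |c| * s := by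
    have h1 := hS.norm_apply_d_le hc' b
    have h2 := mul_le_mul_of_nonneg_left hbs (abs_nonneg c)
    have h3 := mul_le_mul_of_nonneg_left has (abs_nonneg c)
    rw [hsplit]
    linarith [norm_add_le (S (X.d (k + 1) b)) (X.d k (hR.lift b))]
  have hwn : ‖(b : W (k + 1)) + q‖ ≤ (2 * |c| + 1) * s := by
    have h1 : ‖(q : W (k + 1))‖ ≤ s := hqs
    linarith [norm_add_le (b : W (k + 1)) (q : W (k + 1))]
  have hsg : s ≤ (2 * |c| + 1) * ‖g‖ := by
    rcases hs0.eq_or_lt with h0 | hpos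
    · rw [← h0]
      positivity
    · refine le_of_mul_le_mul_right ?_ hpos
      have h1 := mul_le_mul_of_nonneg_left hwn (norm_nonneg g)
      linarith
  have hΦn : ‖Φ‖ ≤ |L| * (2 * |c| + 2) * s := by
    have h1 := X.normV_le (b + X.harmonicToV k q)
    rw [Submodule.coe_add, coe_harmonicToV, LinearPMap.map_add, d_harmonicToV, add_zero] at h1
    have h2 := hL (u + X.harmonicToV k p) (u' + X.harmonicToV k p')
    rw [hbq] at h2
    calc ‖Φ‖ ≤ L * X.normV (b + X.harmonicToV k q) := h2
      _ ≤ |L| * ((2 * |c| + 2) * s) :=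
        mul_le_mul (le_abs_self L) (by linarith) (X.normV_nonneg _) (abs_nonneg L)
      _ = _ := by ring
  have hdan : ‖X.d k a‖ ≤ ‖g‖ + ‖Φ‖ := by
    have h2 := e2 ⟨X.d k a, X.d_mem_domain k a⟩
    rw [X.d_comp_d, inner_zero_right, inner_harmonic_d, real_inner_self_eq_norm_mul_norm] at h2
    have h3 := real_inner_le_norm (g - Φ) (X.d k a)
    rw [inner_sub_left] at h3
    have h4 := mul_le_mul_of_nonneg_right (norm_sub_le g Φ) (norm_nonneg (X.d k a))
    rcases (norm_nonneg (X.d k a)).eq_or_lt with h0 | hpos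
    · rw [← h0]
      positivity
    · exact le_of_mul_le_mul_right (by linarith) hpos
  have h1 := X.normV_le a
  have h2 := X.normV_le b
  have h3 := mul_le_mul_of_nonneg_left hsg
    (by positivity : 0 ≤ 2 * |c| + 3 + |L| * (2 * |c| + 2))
  linarith

end HilbertComplex

theorem mainTheorem2 :
    ∃ C : ℝ → ℝ → ℝ,
      ∀ (W : ℤ → Type u) [∀ k, NormedAddCommGroup (W k)] [∀ k, InnerProductSpace ℝ (W k)]
        [∀ k, CompleteSpace (W k)] (X : HilbertComplex W) (_ : X.IsClosedComplex) (k : ℤ)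
        (F : X.V (k + 1) → W (k + 1)) (_ : X.IsMonotone F) (L : ℝ) (_ : X.IsLipschitzV L F),
        -- existence and uniqueness
        (∀ f : W (k + 1), ∃! x : X.V k × X.V (k + 1) × X.harmonic k,
          X.IsMixedSolution F f x.1 x.2.1 x.2.2) ∧
        -- a Poincaré constant exists, and any one of them controls the Lipschitz estimate
        (∃ cP : ℝ, X.IsPoincareConstant k cP ∧ X.IsPoincareConstant (k + 1) cP) ∧
        (∀ cP : ℝ, X.IsPoincareConstant k cP → X.IsPoincareConstant (k + 1) cP →
          ∀ (f f' : W (k + 1)) (σ σ' : X.V k) (u u' : X.V (k + 1)) (p p' : X.harmonic k),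
            X.IsMixedSolution F f σ u p → X.IsMixedSolution F f' σ' u' p' →
              X.normV (σ - σ') + X.normV (u - u') + ‖p - p'‖ ≤ C cP L * ‖f - f'‖) := by
  refine ⟨fun c L => (2 * |c| + 3 + |L| * (2 * |c| + 2)) * (2 * |c| + 1) + 1, ?_⟩
  intro W _ _ _ X hX k F hF L hL
  have hP : ∃ cP : ℝ, X.IsPoincareConstant k cP ∧ X.IsPoincareConstant (k + 1) cP := by
    obtain ⟨R, hR⟩ := hX.exists_isPseudoinverse k
    obtain ⟨S, hS⟩ := hX.exists_isPseudoinverse (k + 1)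
    exact ⟨max (‖R‖ + 1) (‖S‖ + 1),
      fun v hv => (hR.isPoincareConstant v hv).trans (by gcongr; exact le_max_left _ _),
      fun v hv => (hS.isPoincareConstant v hv).trans (by gcongr; exact le_max_right _ _)⟩
  refine ⟨fun f => ?_, hP, fun cP hc hc' f f' σ σ' u u' p p' h h' =>
    hX.isMixedSolution_sub_le hF hL hc hc' h h'⟩
  obtain ⟨σ, u, p, h⟩ := hX.exists_isMixedSolution hF hL f
  refine ⟨(σ, u, p), h, ?_⟩
  rintro ⟨σ', u', p'⟩ h'
  obtain ⟨cP, hc, hc'⟩ := hP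
  have hle := hX.isMixedSolution_sub_le hF hL hc hc' h' h
  rw [sub_self, norm_zero, mul_zero] at hle
  have h1 := X.normV_nonneg (σ' - σ)
  have h2 := X.normV_nonneg (u' - u)
  have h3 := norm_nonneg (p' - p)
  have hσ : σ' = σ := X.eq_of_normV_sub_eq_zero (by linarith)
  have hu : u' = u := X.eq_of_normV_sub_eq_zero (by linarith)
  have hp : p' = p := sub_eq_zero.1 (norm_eq_zero.1 (by linarith))
  rw [hσ, hu, hp]
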